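/- Let $e \geqslant 3$ be an integer. For $n \in \mathbb N$, let $\mathsf T_n$ be the set of $n\times n$ matrices $M$ with all entries in $\{1,-1\}$, all diagonal entries equal to $1$, and $(M-I)^{\top} = -(M-I)$. For $M \in \mathsf T_n$ write $\det(xI-M)=\sum_{i=0}^n a_i(M)\,x^{n-i}$, put $a_i(M)=0$ for $i>n$, and define \[ \mathcal C_e(\mathsf T_n)=\left\{\left(a_2(M) \bmod 2^e,\ a_3(M) \bmod 2^e,\ \dots,\ a_e(M) \bmod 2^e\right) : M\in\mathsf T_n\right\}\subseteq(\mathbb Z/2^e\mathbb Z)^{e-1}. \] Then there exists an integer $N$ (depending only on $e$) such that for all integers $n > N$, \[ |\mathcal C_e(\mathsf T_n)|=\begin{cases}2^{\lfloor\frac{e-1}{2}\rfloor\lfloor\frac{e-2}{2}\rfloor}, & \text{if } n \text{ is even},\\[3pt] 2^{\lfloor\frac{e-2}{2}\rfloor\lfloor\frac{e-3}{2}\rfloor}, & \text{if } n \text{ is odd}.\end{cases} \] -/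

import Mathlib

/-- The set `U_n` of `n × n` integer matrices all of whose entries are `1` or `-1`
and all of whose diagonal entries are `1`. -/
def signMatrices (n : ℕ) : Set (Matrix (Fin n) (Fin n) ℤ) :=
  {M | (∀ i j, M i j = 1 ∨ M i j = -1) ∧ ∀ i, M i i = 1}

/-- The set `T_n` of skew-symmetric members of `U_n`, where `M ∈ U_n` is called
skew-symmetric when `M - I` is skew-symmetric in the usual sense. -/
def skewSignMatrices (n : ℕ) : Set (Matrix (Fin n) (Fin n) ℤ) :=
  {M | M ∈ signMatrices n ∧ (M - 1).transpose = -(M - 1)}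

/-- The coefficient `a_i` in `det (x I - M) = ∑ i ∈ {0, …, n}, a_i x ^ (n - i)`,
with `a_i = 0` for `i > n`. -/
noncomputable def charCoeff {n : ℕ} (M : Matrix (Fin n) (Fin n) ℤ) (i : ℕ) : ℤ :=
  if i ≤ n then M.charpoly.coeff (n - i) else 0

/-- The set `C_e` of tuples `(a_2 mod 2 ^ e, a_3 mod 2 ^ e, …, a_e mod 2 ^ e)`, indexed by
`{2, 3, …, e}`, arising from the matrices `M` in a given set of integer matrices. -/
def coeffClasses (e : ℕ) {n : ℕ} (S : Set (Matrix (Fin n) (Fin n) ℤ)) :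
    Set (Set.Icc 2 e → ZMod (2 ^ e)) :=
  {c | ∃ M ∈ S, ∀ i : Set.Icc 2 e, c i = (charCoeff M (i : ℕ) : ZMod (2 ^ e))}

/-!
Put `J` for the all-ones matrix. The matrices in `T_n` are the matrices `M = J - 2B`, where `B` is
the `0/1` adjacency matrix of a tournament, that is `B + Bᵀ = J - I`. Let `c_k` be the sum of the
principal `k × k` minors of `B`, so that `det (1 + X B) = ∑ c_k X ^ k`, with `c_0 = 1` and
`c_1 = c_2 = 0`.

*The coefficients in terms of minors.* Both `xI - M = (xI + 2B) - J` and
`(x - 2)I - 2Bᵀ = (xI + 2B) - 2J` arise from `xI + 2B` by subtracting a multiple of `J`, and a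
determinant is affine along the rank one matrix `J`. Hence
`2 det (xI - M) = det (xI + 2B) + det ((x - 2)I - 2Bᵀ)`, which gives
`a_j = 2 ^ (j - 1) (c_j + (-1) ^ j ∑_{i ≤ j} C(n - i, j - i) c_i)` (`IsTournament.charCoeff_eq`).
In particular `2 ^ (j - 1)` divides `a_j`. Moreover `M = 2I - Mᵀ`, so the characteristic polynomial
is symmetric under `x ↦ 2 - x`, which for odd `j` gives
`a_j = -∑_{i < j} 2 ^ (j - i - 1) C(n - i, j - i) a_i` (`IsTournament.charCoeff_odd`).

*Upper bound.* Given `a_i` for `i < j`, modulo `2 ^ e`, the coefficient `a_j` is determined if `j`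
is odd, by this recursion, and for `j ≤ 2`. If `j ≥ 4` is even, it is determined modulo
`2 ^ (j - 1)`; if in addition `n` is odd, it is determined modulo `2 ^ j`, by the recursion for
`a_{j + 1}`, in which `a_j` has the odd coefficient `n - j`
(`two_pow_dvd_coeffSequences_sub`).

*Lower bound.* All these values occur, because for large `n` the tuple `(c_3, ..., c_e)` modulo
`2 ^ e` is arbitrary (`exists_forall_isTournament_minorSum_eq`): changing `c_{j - 1}` (for `n` even)
or `c_j` (for `n` odd) then moves `a_j` through the whole coset, keeping the previous coefficients
(`exists_mem_coeffSequences_add`). The polynomial `det (1 + X B)` is multiplicative for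
ordered sums of tournaments, and modulo `(2 ^ e, X ^ (e + 1))` the polynomials with constant
coefficient `1` form a finite group, so the attained ones form a subgroup. It contains
`f_m = 1 + X ^ 2 (1 - (1 - X) ^ m)`, which comes from a transitive tournament on `m + 2` vertices
with the arc between its source and its sink reversed (`minorPoly_reversedArc`). The passage from a
sequence `f_m` to the ratios `f_{m + 1} / f_m`, iterated `k + 1` times, yields an element
`1 ± X ^ (k + 3) + ...` of the subgroup (`exists_ratioSeq_iterate_dvd`), and such elements, one for
each degree from `3` on, generate everything congruent to `1` modulo `X ^ 3`.

*Counting.* The number of classes is the product of the sizes of the cosets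
(`ncard_initial_segments`), and the exponents add up to the stated value
(`sum_range_even_ge_four`).
-/

open Polynomial Matrix
open scoped PowerSeries

/-! ### Sums of principal minors and tournament matrices -/

namespace Matrix

/-- The sum of the principal `k × k` minors of a square matrix. -/
def minorSum {ι R : Type*} [Fintype ι] [DecidableEq ι] [CommRing R] (A : Matrix ι ι R) (k : ℕ) : R :=
  ∑ s ∈ Finset.univ.powersetCard k, (A.submatrix (Subtype.val : s → ι) (Subtype.val : s → ι)).det

/-- The polynomial `det (1 + X A)`, whose coefficients are the sums of principal minors of `A`. -/
noncomputable def minorPoly {ι R : Type*} [Fintype ι] [DecidableEq ι] [CommRing R]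
    (A : Matrix ι ι R) : R[X] :=
  det (1 + (X : R[X]) • A.map C)

section
variable {ι κ R : Type*} [Fintype ι] [DecidableEq ι] [Fintype κ] [DecidableEq κ] [CommRing R]

theorem coeff_minorPoly (A : Matrix ι ι R) (k : ℕ) : (minorPoly A).coeff k = minorSum A k :=
  coeff_det_one_add_X_smul_eq_sum_minors A k

theorem charpoly_coeff_sub (A : Matrix ι ι R) {k : ℕ} (hk : k ≤ Fintype.card ι) :
    A.charpoly.coeff (Fintype.card ι - k) = (-1) ^ k * minorSum A k :=
  charpoly_coeff_eq_sum_minors A k hk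

theorem minorSum_smul (r : R) (A : Matrix ι ι R) (k : ℕ) :
    minorSum (r • A) k = r ^ k * minorSum A k := by
  rw [minorSum, minorSum, Finset.mul_sum]
  refine Finset.sum_congr rfl fun s hs => ?_
  rw [submatrix_smul, Pi.smul_apply, Pi.smul_apply, det_smul, Fintype.card_coe,
    (Finset.mem_powersetCard.mp hs).2]

theorem minorSum_transpose (A : Matrix ι ι R) (k : ℕ) : minorSum Aᵀ k = minorSum A k := by
  refine Finset.sum_congr rfl fun s _ => ?_
  rw [← det_transpose, transpose_submatrix, transpose_transpose]

theorem minorSum_zero (A : Matrix ι ι R) : minorSum A 0 = 1 := by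
  simp [minorSum]

theorem minorSum_one (A : Matrix ι ι R) : minorSum A 1 = A.trace := by
  rw [← coeff_minorPoly, minorPoly, coeff_det_one_add_X_smul_one]

theorem minorPoly_submatrix_equiv (e : κ ≃ ι) (A : Matrix ι ι R) :
    minorPoly (A.submatrix e e) = minorPoly A := by
  rw [minorPoly, minorPoly, ← det_submatrix_equiv_self e]
  congr 1
  ext i j
  simp [one_apply]

theorem minorPoly_fromBlocks_zero₂₁ (A : Matrix ι ι R) (B : Matrix ι κ R) (D : Matrix κ κ R) :
    minorPoly (fromBlocks A B 0 D) = minorPoly A * minorPoly D := by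
  rw [minorPoly, fromBlocks_map, fromBlocks_smul, ← fromBlocks_one, fromBlocks_add]
  simp only [map_zero, Matrix.map_zero, smul_zero, add_zero]
  rw [det_fromBlocks_zero₂₁, minorPoly, minorPoly]

/-- Replacing `u` by `c u` in the rank one perturbation `P - u vᵀ` changes the determinant
affinely in `c`, as `det (P - c u vᵀ)` is the determinant of `P` bordered by `c u`, `vᵀ` and `1`,
hence affine in the bordering column. -/
theorem two_mul_det_sub_vecMulVec (P : Matrix ι ι R) (u v : ι → R) :
    2 * det (P - vecMulVec u v) = det P + det (P - vecMulVec (2 • u) v) := by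
  let Z : Matrix (ι ⊕ Unit) (ι ⊕ Unit) R := fromBlocks P 0 (replicateRow Unit v) 1
  have key (w : ι → R) :
      det (Z.updateCol (Sum.inr ()) (Sum.elim w 1)) = det (P - vecMulVec w v) := by
    have : Z.updateCol (Sum.inr ()) (Sum.elim w 1) =
        fromBlocks P (replicateCol Unit w) (replicateRow Unit v) 1 := by
      ext (i | i) (j | j) <;> simp [Z]
    rw [this, det_fromBlocks_one₂₂, vecMulVec_eq Unit]
  have h0 := key 0
  have h1 := key u
  have h2 := key (2 • u)
  have e : (2 : R) • (Sum.elim u 1 : ι ⊕ Unit → R) =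
      (Sum.elim 0 1 : ι ⊕ Unit → R) + (Sum.elim (2 • u) 1 : ι ⊕ Unit → R) := by
    ext (i | i)
    · simp
    · norm_num
  rw [zero_vecMulVec, sub_zero] at h0
  rw [← h0, ← h1, ← h2, ← det_updateCol_add, ← e, det_updateCol_smul]

/-- A block determinant in which the upper right block is a multiple of the upper left one. -/
theorem det_fromBlocks_mul₁₂ (D : Matrix ι ι R) (W : Matrix ι κ R) (Q : Matrix κ ι R)
    (E : Matrix κ κ R) : det (fromBlocks D (D * W) Q E) = det D * det (E - Q * W) := by
  have : fromBlocks D (D * W) Q E = fromBlocks D 0 Q (E - Q * W) * fromBlocks 1 W 0 1 := by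
    simp [fromBlocks_multiply]
  rw [this, det_mul, det_fromBlocks_zero₁₂, det_fromBlocks_zero₂₁]
  simp

end

/-- The `0/1` adjacency matrix of a tournament: between two different vertices there is an arc in
exactly one direction, and there are no loops. -/
structure IsTournament {ι : Type*} (B : Matrix ι ι ℤ) : Prop where
  zero_or_one : ∀ i j, B i j = 0 ∨ B i j = 1
  diag : ∀ i, B i i = 0
  add_swap : ∀ i j, i ≠ j → B i j + B j i = 1

theorem IsTournament.submatrix_equiv {ι κ : Type*} {B : Matrix ι ι ℤ} (hB : IsTournament B)
    (e : κ ≃ ι) : IsTournament (B.submatrix e e) :=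
  ⟨fun _ _ => hB.zero_or_one _ _, fun _ => hB.diag _,
    fun _ _ h => hB.add_swap _ _ (e.injective.ne h)⟩

theorem IsTournament.fromBlocks_one_zero {ι κ : Type*} {A : Matrix ι ι ℤ} {B : Matrix κ κ ℤ}
    (hA : IsTournament A) (hB : IsTournament B) :
    IsTournament (fromBlocks A (of fun _ _ => 1) 0 B) := by
  refine ⟨?_, ?_, ?_⟩
  · rintro (i | i) (j | j) <;> simp [hA.zero_or_one, hB.zero_or_one]
  · rintro (i | i) <;> simp [hA.diag, hB.diag]
  · rintro (i | i) (j | j) h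
    · simpa using hA.add_swap i j (by simpa using h)
    · simp
    · simp
    · simpa using hB.add_swap i j (by simpa using h)

theorem IsTournament.minorSum_two {ι : Type*} [Fintype ι] [DecidableEq ι] {B : Matrix ι ι ℤ}
    (hB : IsTournament B) : minorSum B 2 = 0 := by
  refine Finset.sum_eq_zero fun s hs => ?_
  obtain ⟨e⟩ : Nonempty (Fin 2 ≃ s) :=
    ⟨(Fintype.equivFinOfCardEq (by simpa using hs)).symm⟩
  rw [← det_submatrix_equiv_self e, det_fin_two]
  have h01 : (e 0 : ι) ≠ e 1 := fun h => by simpa using e.injective (Subtype.ext h)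
  have h := hB.add_swap _ _ h01
  rcases hB.zero_or_one (e 0) (e 1) with h0 | h0 <;> simp [hB.diag, h0]
  omega

theorem IsTournament.minorSum_one {ι : Type*} [Fintype ι] [DecidableEq ι] {B : Matrix ι ι ℤ}
    (hB : IsTournament B) : minorSum B 1 = 0 := by
  rw [Matrix.minorSum_one]
  exact Finset.sum_eq_zero fun i _ => hB.diag i

end Matrix

theorem mem_skewSignMatrices_iff {n : ℕ} (M : Matrix (Fin n) (Fin n) ℤ) :
    M ∈ skewSignMatrices n ↔ ∃ B : Matrix (Fin n) (Fin n) ℤ, IsTournament B ∧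
      M = of fun i j => 1 - 2 * B i j := by
  constructor
  · rintro ⟨⟨h1, h2⟩, h3⟩
    have h4 (i j) (h : i ≠ j) : M j i = - M i j := by
      simpa [one_apply, h, h.symm] using congrFun₂ h3 i j
    refine ⟨of fun i j => if M i j = 1 then 0 else 1, ⟨?_, ?_, ?_⟩, ?_⟩
    · intro i j; by_cases h : M i j = 1 <;> simp [h]
    · intro i; simp [h2]
    · intro i j h
      rcases h1 i j with h5 | h5 <;> simp [h4 i j h, h5]
    · ext i j
      rcases h1 i j with h5 | h5 <;> simp [h5]
  · rintro ⟨B, hB, rfl⟩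
    refine ⟨⟨fun i j => ?_, fun i => ?_⟩, ?_⟩
    · rcases hB.zero_or_one i j with h | h <;> simp [h]
    · simp [hB.diag]
    · ext i j
      rcases eq_or_ne i j with rfl | h
      · simp [hB.diag]
      · have := hB.add_swap i j h
        simp [one_apply, h, h.symm]
        omega

theorem Matrix.charpoly_coeff_sub_fin {n k : ℕ} (N : Matrix (Fin n) (Fin n) ℤ) (hk : k ≤ n) :
    N.charpoly.coeff (n - k) = (-1) ^ k * minorSum N k := by
  simpa using charpoly_coeff_sub N (k := k) (by simpa using hk)

theorem Matrix.coeff_charpoly_comp_X_sub_two {n j : ℕ} (N : Matrix (Fin n) (Fin n) ℤ)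
    (hjn : j ≤ n) :
    (N.charpoly.comp (X + C (-2))).coeff (n - j) = ∑ i ∈ Finset.range (j + 1),
      (-2) ^ (j - i) * ((n - i).choose (j - i) : ℤ) * ((-1) ^ i * minorSum N i) := by
  have hd : N.charpoly.natDegree < n + 1 := by
    rw [charpoly_natDegree_eq_dim]; simp
  rw [Polynomial.comp, eval₂_eq_sum_range' _ hd, ← Finset.sum_range_reflect, finsetSum_coeff]
  have hsub : Finset.range (j + 1) ⊆ Finset.range (n + 1) := by
    simpa using hjn
  rw [← Finset.sum_subset hsub]
  · refine Finset.sum_congr rfl fun i hi => ?_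
    have hij : i ≤ j := by simpa [Nat.lt_succ_iff] using hi
    rw [show n + 1 - 1 - i = n - i by omega, coeff_C_mul, coeff_X_add_C_pow,
      charpoly_coeff_sub_fin _ (hij.trans hjn),
      show n - i - (n - j) = j - i by omega,
      Nat.choose_symm_of_eq_add (show n - i = (n - j) + (j - i) by omega)]
    ring
  · intro i hi hi'
    simp only [Finset.mem_range] at hi hi'
    rw [show n + 1 - 1 - i = n - i by omega, coeff_C_mul, coeff_X_add_C_pow,
      Nat.choose_eq_zero_of_lt (by omega)]
    simp

namespace Matrix.IsTournament
variable {n : ℕ} {B : Matrix (Fin n) (Fin n) ℤ}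

/-- With `J` the all-ones matrix, `xI - (J - 2B)` and `xI + 2B - 2J = (x - 2)I - 2Bᵀ` are
perturbations of `xI + 2B` by `J` and by `2J`, so the rank one formula applies. -/
theorem two_mul_charpoly (hB : IsTournament B) :
    2 * (of fun i j => 1 - 2 * B i j : Matrix (Fin n) (Fin n) ℤ).charpoly =
      ((-2 : ℤ) • B).charpoly + ((2 : ℤ) • Bᵀ).charpoly.comp (X + C (-2)) := by
  have h := two_mul_det_sub_vecMulVec (charmatrix ((-2 : ℤ) • B)) (1 : Fin n → ℤ[X]) 1
  have e1 : charmatrix ((-2 : ℤ) • B) - vecMulVec 1 1 =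
      charmatrix (of fun i j => 1 - 2 * B i j) := by
    ext1 i j
    simp only [sub_apply, charmatrix_apply, smul_apply, vecMulVec_apply, of_apply]
    simp
    ring
  have e2 : charmatrix ((-2 : ℤ) • B) - vecMulVec (2 • 1) 1 =
      charmatrix ((2 : ℤ) • Bᵀ - scalar (Fin n) (-2)) := by
    ext1 i j
    simp only [sub_apply, charmatrix_apply, smul_apply, vecMulVec_apply, transpose_apply,
      scalar_apply]
    rcases eq_or_ne i j with rfl | hij
    · simp [hB.diag]
    · have : B j i = 1 - B i j := by have := hB.add_swap i j hij; omega
      simp [hij, this]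
      ring
  rw [e1, e2] at h
  rw [← charpoly_sub_scalar]
  exact h

theorem charCoeff_eq (hB : IsTournament B) {j : ℕ} (hj : 1 ≤ j) (hjn : j ≤ n) :
    charCoeff (of fun i j => 1 - 2 * B i j : Matrix (Fin n) (Fin n) ℤ) j =
      2 ^ (j - 1) * (minorSum B j +
        (-1) ^ j * ∑ i ∈ Finset.range (j + 1), ((n - i).choose (j - i) : ℤ) * minorSum B i) := by
  have h1 : ((-2 : ℤ) • B).charpoly.coeff (n - j) = 2 ^ j * minorSum B j := by
    rw [charpoly_coeff_sub_fin _ hjn, minorSum_smul, ← mul_assoc, ← mul_pow]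
    norm_num
  have h2 : (((2 : ℤ) • Bᵀ).charpoly.comp (X + C (-2))).coeff (n - j) =
      2 ^ j * ((-1) ^ j *
        ∑ i ∈ Finset.range (j + 1), ((n - i).choose (j - i) : ℤ) * minorSum B i) := by
    rw [coeff_charpoly_comp_X_sub_two _ hjn, Finset.mul_sum, Finset.mul_sum]
    refine Finset.sum_congr rfl fun i hi => ?_
    obtain ⟨d, rfl⟩ := Nat.exists_eq_add_of_le (show i ≤ j by simpa [Nat.lt_succ_iff] using hi)
    rw [minorSum_smul, minorSum_transpose, Nat.add_sub_cancel_left, pow_add, pow_add, neg_pow 2 d]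
    ring
  have h := congrArg (fun p => coeff p (n - j)) hB.two_mul_charpoly
  simp only [coeff_add, h1, h2] at h
  rw [show (2 : ℤ[X]) = C 2 from rfl, coeff_C_mul] at h
  rw [charCoeff, if_pos hjn]
  obtain ⟨k, rfl⟩ : ∃ k, j = k + 1 := ⟨j - 1, by omega⟩
  rw [Nat.add_sub_cancel]
  rw [pow_succ (2 : ℤ)] at h
  linarith

/-- Since `M = 2I - Mᵀ`, the characteristic polynomial of `M` is symmetric under `x ↦ 2 - x`. This
expresses its coefficients of odd index in terms of the preceding ones. -/
theorem charCoeff_odd (hB : IsTournament B) {j : ℕ} (hj : Odd j) (hjn : j ≤ n) :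
    charCoeff (of fun i j => 1 - 2 * B i j : Matrix (Fin n) (Fin n) ℤ) j =
      -∑ i ∈ Finset.range j, 2 ^ (j - i - 1) * ((n - i).choose (j - i) : ℤ) *
        charCoeff (of fun i j => 1 - 2 * B i j : Matrix (Fin n) (Fin n) ℤ) i := by
  set M : Matrix (Fin n) (Fin n) ℤ := of fun i j => 1 - 2 * B i j with hM
  have hsymm : M = (-1 : ℤ) • Mᵀ - scalar (Fin n) (-2) := by
    ext i j
    rw [sub_apply, smul_apply, transpose_apply, scalar_apply]
    rcases eq_or_ne i j with rfl | h
    · simp [hM, hB.diag]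
    · have := hB.add_swap i j h
      simp [hM, h]
      omega
  have ha {i : ℕ} (hi : i ≤ n) : charCoeff M i = (-1) ^ i * minorSum M i := by
    rw [charCoeff, if_pos hi, charpoly_coeff_sub_fin _ hi]
  have h : charCoeff M j = ∑ i ∈ Finset.range (j + 1),
      (-2) ^ (j - i) * ((n - i).choose (j - i) : ℤ) * ((-1) ^ i * charCoeff M i) := by
    rw [charCoeff, if_pos hjn]
    conv_lhs => rw [hsymm]
    rw [charpoly_sub_scalar, coeff_charpoly_comp_X_sub_two _ hjn]
    refine Finset.sum_congr rfl fun i hi => ?_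
    rw [ha ((Nat.lt_succ_iff.mp (Finset.mem_range.mp hi)).trans hjn), minorSum_smul,
      minorSum_transpose]
  have h2 : (2 : ℤ) * ∑ i ∈ Finset.range j, 2 ^ (j - i - 1) * ((n - i).choose (j - i) : ℤ) *
      charCoeff M i = -∑ i ∈ Finset.range j,
      (-2) ^ (j - i) * ((n - i).choose (j - i) : ℤ) * ((-1) ^ i * charCoeff M i) := by
    rw [Finset.mul_sum, ← Finset.sum_neg_distrib]
    refine Finset.sum_congr rfl fun i hi => ?_
    obtain ⟨d, rfl⟩ := Nat.exists_eq_add_of_lt (Finset.mem_range.mp hi)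
    have hs : ((-1) ^ (d + 1) * (-1) ^ i : ℤ) = -1 := by
      rw [← pow_add, show d + 1 + i = i + d + 1 by omega, hj.neg_one_pow]
    rw [show i + d + 1 - i = d + 1 by omega, Nat.add_sub_cancel, neg_pow (2 : ℤ) (d + 1)]
    linear_combination (2 ^ (d + 1) * ((n - i).choose (d + 1) : ℤ) * charCoeff M i) * hs
  rw [Finset.sum_range_succ, Nat.sub_self, hj.neg_one_pow] at h
  simp only [pow_zero, Nat.choose_zero_right, Nat.cast_one, one_mul] at h
  linarith

end Matrix.IsTournament

/-! ### A family of tournaments, and iterated ratios of sequences of units -/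

namespace Matrix

/-- The adjacency matrix of the tournament made of a transitive tournament on `m` vertices, a
vertex `0` with arcs to all of them and a vertex `1` with arcs from all of them, and the arc from
`1` to `0`. -/
def reversedArc (m : ℕ) : Matrix (Fin m ⊕ Fin 2) (Fin m ⊕ Fin 2) ℤ :=
  fromBlocks (of fun i j => if j < i then 1 else 0) (of fun _ k => if k = 1 then 1 else 0)
    (of fun k _ => if k = 0 then 1 else 0) !![0, 0; 1, 0]

theorem isTournament_reversedArc (m : ℕ) : IsTournament (reversedArc m) := by
  refine ⟨?_, ?_, ?_⟩
  · rintro (i | i) (j | j)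
    · by_cases h : j < i <;> simp [reversedArc, h]
    · by_cases h : j = 1 <;> simp [reversedArc, h]
    · by_cases h : i = 0 <;> simp [reversedArc, h]
    · fin_cases i <;> fin_cases j <;> simp [reversedArc]
  · rintro (i | i)
    · simp [reversedArc]
    · fin_cases i <;> simp [reversedArc]
  · rintro (i | i) (j | j) h
    · have h' : i ≠ j := by simpa using h
      rcases lt_or_gt_of_ne h' with h1 | h1 <;> simp [reversedArc, h1, h1.not_gt]
    · fin_cases j <;> simp [reversedArc]
    · fin_cases i <;> simp [reversedArc]
    · fin_cases i <;> fin_cases j <;> simp [reversedArc] at h ⊢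

theorem X_mul_geom_sum_one_sub (k : ℕ) :
    (X : ℤ[X]) * ∑ i ∈ Finset.range k, (1 - X) ^ i = 1 - (1 - X) ^ k := by
  have := mul_geom_sum (1 - X : ℤ[X]) k
  linear_combination -this

/-- With `L` the strictly lower triangular matrix of ones, the vector `((1 - X) ^ i)ᵢ` solves
`(1 + X L) w = 1`; this evaluates the Schur complement of the transitive block. -/
theorem minorPoly_reversedArc (m : ℕ) :
    minorPoly (reversedArc m) = 1 + X ^ 2 * (1 - (1 - X) ^ m) := by
  let D : Matrix (Fin m) (Fin m) ℤ[X] := 1 + of fun i j => if j < i then X else 0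
  let W : Matrix (Fin m) (Fin 2) ℤ[X] := of fun i k => if k = 1 then X * (1 - X) ^ (i : ℕ) else 0
  let Q : Matrix (Fin 2) (Fin m) ℤ[X] := of fun k _ => if k = 0 then X else 0
  have hDW : D * W = of fun _ k => if k = 1 then X else 0 := by
    ext1 i k
    by_cases hk : k = 1
    · have h1 : (∑ j : Fin m, if j < i then X * (X * (1 - X) ^ (j : ℕ)) else 0 : ℤ[X]) =
          X * (1 - (1 - X) ^ (i : ℕ)) := by
        have h2 := Fin.sum_univ_eq_sum_range
          (fun j => if j < (i : ℕ) then X * (X * (1 - X) ^ j) else 0 : ℕ → ℤ[X]) m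
        simp only [Fin.val_fin_lt] at h2
        rw [h2, ← Finset.sum_filter, ← X_mul_geom_sum_one_sub, Finset.mul_sum, Finset.mul_sum]
        refine Finset.sum_congr ?_ fun _ _ => rfl
        ext j
        simp only [Finset.mem_filter, Finset.mem_range]
        omega
      have h3 : (D * W) i k = W i k + ∑ j, (if j < i then X else 0) * W j k := by
        rw [show D = 1 + _ from rfl, Matrix.add_mul, Matrix.one_mul, add_apply, mul_apply]
        rfl
      rw [h3]
      simp only [W, of_apply, if_pos hk, ite_mul, zero_mul, h1]
      ring
    · simp [W, hk, mul_apply]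
  have hdet : det D = 1 := by
    rw [det_of_isLowerTriangular]
    · simp [D]
    · intro i j hij
      have hij' : i < j := by simpa using hij
      simp [D, hij'.ne, hij'.not_gt]
  have hblock : 1 + (X : ℤ[X]) • (reversedArc m).map C =
      fromBlocks D (D * W) Q !![1, 0; X, 1] := by
    rw [hDW]
    ext1 (i | i) (j | j)
    · by_cases h : j < i <;> simp [reversedArc, D, h, one_apply]
    · by_cases h : j = 1 <;> simp [reversedArc, h]
    · by_cases h : i = 0 <;> simp [reversedArc, Q, h]
    · fin_cases i <;> fin_cases j <;> simp [reversedArc]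
  have hsum : (∑ j : Fin m, X * (X * (1 - X) ^ (j : ℕ)) : ℤ[X]) = X * (1 - (1 - X) ^ m) := by
    rw [Fin.sum_univ_eq_sum_range (fun j => X * (X * (1 - X) ^ j) : ℕ → ℤ[X]) m,
      ← X_mul_geom_sum_one_sub, Finset.mul_sum, Finset.mul_sum]
  rw [minorPoly, hblock, det_fromBlocks_mul₁₂, hdet, det_fin_two]
  simp [Q, W, mul_apply, hsum]
  ring

end Matrix

section Differences

variable {P : Type*} [CommRing P]

/-- `DvdDiffs t n a φ` says that `t ^ (a + j)` divides all values of the `j`-th forward difference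
of `φ`, for every `j ≤ n`. -/
def DvdDiffs (t : P) : ℕ → ℕ → (ℕ → P) → Prop
  | 0, a, φ => ∀ m, t ^ a ∣ φ m
  | n + 1, a, φ => (∀ m, t ^ a ∣ φ m) ∧ DvdDiffs t n (a + 1) fun m => φ (m + 1) - φ m

namespace DvdDiffs
variable {t : P} {n a b : ℕ} {φ ψ : ℕ → P}

theorem dvd (h : DvdDiffs t n a φ) (m : ℕ) : t ^ a ∣ φ m := by
  cases n with
  | zero => exact h m
  | succ n => exact h.1 m

theorem of_succ (h : DvdDiffs t (n + 1) a φ) : DvdDiffs t n a φ := by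
  induction n generalizing a φ with
  | zero => exact h.1
  | succ n ih => exact ⟨h.1, ih h.2⟩

theorem mono (h : DvdDiffs t n b φ) (hab : a ≤ b) : DvdDiffs t n a φ := by
  induction n generalizing a b φ with
  | zero => exact fun m => (pow_dvd_pow t hab).trans (h m)
  | succ n ih => exact ⟨fun m => (pow_dvd_pow t hab).trans (h.1 m), ih h.2 (by omega)⟩

theorem add (h : DvdDiffs t n a φ) (h' : DvdDiffs t n a ψ) :
    DvdDiffs t n a fun m => φ m + ψ m := by
  induction n generalizing a φ ψ with
  | zero => exact fun m => dvd_add (h m) (h' m)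
  | succ n ih =>
    refine ⟨fun m => dvd_add (h.1 m) (h'.1 m), ?_⟩
    simpa only [add_sub_add_comm] using ih h.2 h'.2

theorem shift (h : DvdDiffs t n a φ) : DvdDiffs t n a fun m => φ (m + 1) := by
  induction n generalizing a φ with
  | zero => exact fun m => h (m + 1)
  | succ n ih => exact ⟨fun m => h.1 (m + 1), ih h.2⟩

theorem mul (h : DvdDiffs t n a φ) (h' : DvdDiffs t n b ψ) :
    DvdDiffs t n (a + b) fun m => φ m * ψ m := by
  induction n generalizing a b φ ψ with
  | zero => exact fun m => pow_add t a b ▸ mul_dvd_mul (h m) (h' m)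
  | succ n ih =>
    refine ⟨fun m => pow_add t a b ▸ mul_dvd_mul (h.1 m) (h'.1 m), ?_⟩
    have h1 := ih h.2 h'.of_succ.shift
    have h2 := ih h.of_succ h'.2
    rw [show a + 1 + b = a + b + 1 by ring] at h1
    rw [show a + (b + 1) = a + b + 1 by ring] at h2
    convert h1.add h2 using 2
    ring

theorem neg (h : DvdDiffs t n a φ) : DvdDiffs t n a fun m => -φ m := by
  induction n generalizing a φ with
  | zero => exact fun m => (h m).neg_right
  | succ n ih =>
    refine ⟨fun m => (h.1 m).neg_right, ?_⟩
    convert ih h.2 using 2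
    ring

/-- As `Δ(1/f) = -Δf / (f(m) f(m + 1))`, inversion preserves `DvdDiffs t n 0`. -/
theorem of_mul_eq_one (h : DvdDiffs t n 0 φ) (hφψ : ∀ m, φ m * ψ m = 1) : DvdDiffs t n 0 ψ := by
  induction n with
  | zero => exact fun m => by simp
  | succ n ih =>
    have h1 := ih h.of_succ
    refine ⟨fun m => by simp, ?_⟩
    convert h.2.neg.mul (h1.mul h1.shift) using 2 with m
    linear_combination ψ m * hφψ (m + 1) - ψ (m + 1) * hφψ m

theorem zero : DvdDiffs t n a fun _ => (0 : P) := by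
  induction n generalizing a with
  | zero => exact fun m => dvd_zero _
  | succ n ih => exact ⟨fun m => dvd_zero _, by simpa only [sub_self] using ih⟩

theorem const {x : P} (hx : t ^ a ∣ x) : DvdDiffs t n a fun _ => x := by
  cases n with
  | zero => exact fun m => hx
  | succ n => exact ⟨fun m => hx, by simpa only [sub_self] using zero⟩

theorem units_inv {f : ℕ → Pˣ} (hf : DvdDiffs t n a fun m => (f m : P) - 1) :
    DvdDiffs t n 0 fun m => ((f m)⁻¹ : Pˣ).val := by
  refine of_mul_eq_one (φ := fun m => (f m : P)) ?_ fun m => by simp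
  convert (hf.mono (Nat.zero_le a)).add (const (x := 1) (by simp)) using 2
  ring

/-- The differences of `(1 - t) ^ m` are its multiples by powers of `-t`. -/
theorem geometric (c : P) : DvdDiffs t n a fun m => t ^ a * (c * (1 - t) ^ m) := by
  induction n generalizing a c with
  | zero => exact fun m => dvd_mul_right _ _
  | succ n ih =>
    refine ⟨fun m => dvd_mul_right _ _, ?_⟩
    convert ih (a := a + 1) (-c) using 2
    ring

end DvdDiffs

/-- The multiplicative forward difference of a sequence of units. -/
def ratioSeq (f : ℕ → Pˣ) : ℕ → Pˣ := fun m => f (m + 1) / f m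

theorem val_ratioSeq (f : ℕ → Pˣ) (m : ℕ) :
    (ratioSeq f m : P) = f (m + 1) * ((f m)⁻¹ : Pˣ) := by
  rw [ratioSeq, div_eq_mul_inv, Units.val_mul]

/-- If `f m = 1 + t ^ a c (1 - t) ^ m` up to a sequence in the next step of the filtration
`DvdDiffs`, then its sequence of ratios has the same form with `a + 1` and `-c`. -/
theorem ratioSeq_step {t : P} {a : ℕ} {c : P} {f : ℕ → Pˣ} (ha : 1 ≤ a)
    (hf : ∀ n, DvdDiffs t n (a + 1) fun m => (f m : P) - 1 - t ^ a * (c * (1 - t) ^ m)) (n : ℕ) :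
    DvdDiffs t n (a + 2) fun m =>
      (ratioSeq f m : P) - 1 - t ^ (a + 1) * (-c * (1 - t) ^ m) := by
  have h1 (n : ℕ) : DvdDiffs t n a fun m => (f m : P) - 1 := by
    convert ((hf n).mono (Nat.le_succ a)).add (DvdDiffs.geometric (t := t) (n := n) (a := a) c)
      using 2
    ring
  -- `ratioSeq f - 1 = Δf - Δf (f - 1) / f`, and the second summand is of higher order
  have h2 := (hf (n + 1)).2
  have h3 := ((h1 (n + 1)).2.mul ((h1 n).mul (h1 n).units_inv)).neg.mono (show a + 2 ≤ _ by omega)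
  convert h2.add h3 using 2 with m
  have h4 : (f m : P) * ((f m)⁻¹ : Pˣ) = 1 := by simp
  rw [val_ratioSeq]
  linear_combination (f (m + 1) + 1 - f m : P) * h4

/-- Iterated ratios of `f m = 1 + t ^ 2 (1 - (1 - t) ^ m)` are `1 ± t ^ (k + 2)` up to higher
powers of `t`. -/
theorem exists_ratioSeq_iterate_dvd {t : P} {f : ℕ → Pˣ}
    (hf : ∀ m, (f m : P) = 1 + t ^ 2 * (1 - (1 - t) ^ m)) (k : ℕ) :
    ∃ c : Pˣ, t ^ (k + 4) ∣ (ratioSeq^[k + 1] f 0 : P) - 1 - t ^ (k + 3) * c := by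
  have key : ∀ n, DvdDiffs t n (k + 3 + 1) fun m =>
      (ratioSeq^[k + 1] f m : P) - 1 - t ^ (k + 3) * (((-1) ^ k : P) * (1 - t) ^ m) := by
    induction k with
    | zero =>
      intro n
      have h1 : DvdDiffs t n 2 fun m => (f m : P) - 1 := by
        convert (DvdDiffs.const (dvd_refl (t ^ 2))).add
          (DvdDiffs.geometric (t := t) (n := n) (a := 2) (-1)) using 2
        rw [hf]
        ring
      have h2 := ((DvdDiffs.geometric (t := t) (n := n) (a := 3) (-1)).mul
        (h1.mul h1.units_inv)).mono (show 4 ≤ _ by omega)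
      convert h2 using 2 with m
      have h3 : (f m : P) * ((f m)⁻¹ : Pˣ) = 1 := by simp
      have h4 : (f (m + 1) : P) = f m + t ^ 3 * (1 - t) ^ m := by rw [hf, hf]; ring
      rw [Function.iterate_one, val_ratioSeq, h4]
      linear_combination (1 + t ^ 3 * (1 - t) ^ m) * h3
    | succ k ih =>
      intro n
      rw [Function.iterate_succ_apply']
      convert ratioSeq_step (by omega) ih n using 3
      ring
  refine ⟨(-1) ^ k, ?_⟩
  simpa using (key 0).dvd 0

end Differences

/-! ### Power series of tournaments modulo `q` -/

/-- The polynomial `det (1 + X A)` of an integer matrix, as a power series modulo `q`. -/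
noncomputable def minorSeries (q : ℕ) {ι : Type*} [Fintype ι] [DecidableEq ι] (A : Matrix ι ι ℤ) :
    (ZMod q)⟦X⟧ :=
  ((minorPoly A).map (Int.castRingHom (ZMod q)) : (ZMod q)[X])

/-- A power series over `ZMod q` is a tournament series to order `d` if it agrees modulo `X ^ d`
with `det (1 + X A)` for the adjacency matrix `A` of some tournament. -/
def IsTournamentSeries (q d : ℕ) (u : (ZMod q)⟦X⟧) : Prop :=
  ∃ (n : ℕ) (A : Matrix (Fin n) (Fin n) ℤ), IsTournament A ∧ PowerSeries.X ^ d ∣ u - minorSeries q A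

section
variable {q d : ℕ}

theorem coeff_minorSeries {ι : Type*} [Fintype ι] [DecidableEq ι] (A : Matrix ι ι ℤ) (i : ℕ) :
    PowerSeries.coeff i (minorSeries q A) = ((minorSum A i : ℤ) : ZMod q) := by
  simp [minorSeries, coeff_minorPoly]

theorem X_dvd_minorSeries_sub_one {ι : Type*} [Fintype ι] [DecidableEq ι] (A : Matrix ι ι ℤ) :
    PowerSeries.X ∣ minorSeries q A - 1 := by
  rw [PowerSeries.X_dvd_iff, ← PowerSeries.coeff_zero_eq_constantCoeff_apply, map_sub,
    coeff_minorSeries, minorSum_zero]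
  simp

/-- The ordered sum of two tournaments, with all arcs from the first to the second, has the product
series. -/
theorem exists_isTournament_minorPoly_mul {a b : ℕ} {A : Matrix (Fin a) (Fin a) ℤ}
    {B : Matrix (Fin b) (Fin b) ℤ} (hA : IsTournament A) (hB : IsTournament B) :
    ∃ D : Matrix (Fin (a + b)) (Fin (a + b)) ℤ,
      IsTournament D ∧ minorPoly D = minorPoly A * minorPoly B :=
  ⟨_, (hA.fromBlocks_one_zero hB).submatrix_equiv finSumFinEquiv.symm, by
    rw [minorPoly_submatrix_equiv, minorPoly_fromBlocks_zero₂₁]⟩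

namespace IsTournamentSeries

theorem of_dvd_sub {u v : (ZMod q)⟦X⟧} (hu : IsTournamentSeries q d u)
    (h : PowerSeries.X ^ d ∣ v - u) : IsTournamentSeries q d v := by
  obtain ⟨n, A, hA, hd⟩ := hu
  exact ⟨n, A, hA, by simpa using dvd_add h hd⟩

theorem one : IsTournamentSeries q d 1 :=
  ⟨0, 0, ⟨fun i => i.elim0, fun i => i.elim0, fun i => i.elim0⟩, by
    simp [minorSeries, minorPoly]⟩

theorem mul {u v : (ZMod q)⟦X⟧} (hu : IsTournamentSeries q d u) (hv : IsTournamentSeries q d v) :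
    IsTournamentSeries q d (u * v) := by
  obtain ⟨a, A, hA, hAd⟩ := hu
  obtain ⟨b, B, hB, hBd⟩ := hv
  obtain ⟨D, hD, hDm⟩ := exists_isTournament_minorPoly_mul hA hB
  refine ⟨a + b, D, hD, ?_⟩
  have : minorSeries q D = minorSeries q A * minorSeries q B := by simp [minorSeries, hDm]
  rw [this, show u * v - minorSeries q A * minorSeries q B =
    (u - minorSeries q A) * v + minorSeries q A * (v - minorSeries q B) by ring]
  exact dvd_add (hAd.mul_right _) (hBd.mul_left _)

theorem pow {u : (ZMod q)⟦X⟧} (hu : IsTournamentSeries q d u) (n : ℕ) :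
    IsTournamentSeries q d (u ^ n) := by
  induction n with
  | zero => simpa using one
  | succ n ih => simpa [pow_succ] using ih.mul hu

theorem X_dvd_sub_one {u : (ZMod q)⟦X⟧} (hu : IsTournamentSeries q (d + 1) u) :
    PowerSeries.X ∣ u - 1 := by
  obtain ⟨n, A, -, hd⟩ := hu
  simpa using dvd_add ((dvd_pow_self _ (Nat.succ_ne_zero d)).trans hd)
    (X_dvd_minorSeries_sub_one (q := q) A)

theorem reversedArc (m : ℕ) :
    IsTournamentSeries q d (1 + PowerSeries.X ^ 2 * (1 - (1 - PowerSeries.X) ^ m)) := by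
  refine ⟨m + 2, _, (isTournament_reversedArc m).submatrix_equiv finSumFinEquiv.symm, ?_⟩
  rw [minorSeries, minorPoly_submatrix_equiv, minorPoly_reversedArc]
  simp

end IsTournamentSeries

/-- In characteristic `q`, raising to the power `q` a power series congruent to `1` modulo `X ^ i`,
`i ≥ 1`, gives one congruent to `1` modulo `X ^ (i + 1)`. -/
theorem X_pow_dvd_pow_sub_one {u : (ZMod q)⟦X⟧} (hu : PowerSeries.X ∣ u - 1) (i : ℕ) :
    PowerSeries.X ^ (i + 1) ∣ u ^ q ^ i - 1 := by
  induction i with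
  | zero => simpa using hu
  | succ i ih =>
    set v := u ^ q ^ i with hv
    have h1 : PowerSeries.X ∣ ∑ j ∈ Finset.range q, v ^ j := by
      have h2 : ∑ j ∈ Finset.range q, v ^ j = ∑ j ∈ Finset.range q, (v ^ j - 1) := by
        have hq : (q : (ZMod q)⟦X⟧) = 0 := by
          rw [← map_natCast (PowerSeries.C (R := ZMod q)), ZMod.natCast_self, map_zero]
        simp [Finset.sum_sub_distrib, hq]
      rw [h2]
      refine Finset.dvd_sum fun j _ => ?_
      exact ((dvd_pow_self _ (Nat.succ_ne_zero i)).trans ih).trans (sub_one_dvd_pow_sub_one v j)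
    rw [pow_succ q, pow_mul, ← hv, ← mul_geom_sum, pow_succ]
    exact mul_dvd_mul ih h1

namespace IsTournamentSeries

theorem units_inv [NeZero q] {u : ((ZMod q)⟦X⟧)ˣ}
    (hu : IsTournamentSeries q (d + 1) (u : (ZMod q)⟦X⟧)) :
    IsTournamentSeries q (d + 1) ((u⁻¹ : ((ZMod q)⟦X⟧)ˣ) : (ZMod q)⟦X⟧) := by
  refine (hu.pow (q ^ d - 1)).of_dvd_sub ?_
  have h1 := X_pow_dvd_pow_sub_one hu.X_dvd_sub_one d
  have h2 : (u : (ZMod q)⟦X⟧) ^ q ^ d = u ^ (q ^ d - 1) * u := by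
    rw [← pow_succ, Nat.sub_add_cancel (Nat.one_le_pow _ _ (NeZero.pos q))]
  have h3 : (u : (ZMod q)⟦X⟧) * (u⁻¹ : ((ZMod q)⟦X⟧)ˣ) = 1 := by simp
  rw [h2] at h1
  convert h1.mul_right (-((u⁻¹ : ((ZMod q)⟦X⟧)ˣ) : (ZMod q)⟦X⟧)) using 1
  linear_combination (u : (ZMod q)⟦X⟧) ^ (q ^ d - 1) * h3

/-- In every degree from `3` on there is a tournament series whose first coefficient after the
constant one is a unit. -/
theorem exists_leading_unit [NeZero q] (d k : ℕ) :
    ∃ u : (ZMod q)⟦X⟧, ∃ c : ((ZMod q)⟦X⟧)ˣ, IsTournamentSeries q (d + 1) u ∧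
      PowerSeries.X ^ (k + 4) ∣ u - 1 - PowerSeries.X ^ (k + 3) * (c : (ZMod q)⟦X⟧) := by
  have hunit (m : ℕ) :
      IsUnit (1 + PowerSeries.X ^ 2 * (1 - (1 - PowerSeries.X) ^ m) : (ZMod q)⟦X⟧) := by
    rw [PowerSeries.isUnit_iff_constantCoeff]
    simp
  choose f hf using hunit
  obtain ⟨c, hc⟩ := exists_ratioSeq_iterate_dvd hf k
  refine ⟨_, c, ?_, hc⟩
  have key : ∀ j m, IsTournamentSeries q (d + 1) (ratioSeq^[j] f m : (ZMod q)⟦X⟧) := by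
    intro j
    induction j with
    | zero => intro m; rw [Function.iterate_zero, id, hf]; exact reversedArc m
    | succ j ih =>
      intro m
      rw [Function.iterate_succ_apply', val_ratioSeq]
      exact (ih (m + 1)).mul (ih m).units_inv
  exact key _ _

end IsTournamentSeries

theorem dvd_pow_sub_one_sub {P : Type*} [CommRing P] {t u c : P} {i : ℕ}
    (h : t ^ (i + 2) ∣ u - 1 - t ^ (i + 1) * c) (j : ℕ) :
    t ^ (i + 2) ∣ u ^ j - 1 - t ^ (i + 1) * (j * c) := by
  induction j with
  | zero => simp
  | succ j ih =>
    obtain ⟨x, hx⟩ := h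
    obtain ⟨y, hy⟩ := ih
    refine ⟨x * u ^ j + y + t ^ i * c * (j * c) + t ^ (i + 1) * c * y, ?_⟩
    push_cast
    rw [pow_succ u]
    linear_combination u ^ j * hx + (1 + t ^ (i + 1) * c) * hy

/-- Every power series congruent to `1` modulo `X ^ 3` is a tournament series: its coefficients are
matched one after the other, multiplying by powers of a series that starts in the right degree. -/
theorem isTournamentSeries_of_X_pow_three_dvd [NeZero q] (d : ℕ) {h : (ZMod q)⟦X⟧}
    (hh : PowerSeries.X ^ 3 ∣ h - 1) : IsTournamentSeries q (d + 1) h := by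
  have key (k : ℕ) :
      ∃ v, IsTournamentSeries q (d + 1) v ∧ PowerSeries.X ^ (k + 3) ∣ h - v := by
    induction k with
    | zero => exact ⟨1, .one, hh⟩
    | succ k ih =>
      obtain ⟨v, hv, w, hw⟩ := ih
      obtain ⟨u, c, hu, hc⟩ := IsTournamentSeries.exists_leading_unit (q := q) d k
      set a := PowerSeries.constantCoeff w *
        PowerSeries.constantCoeff ((c⁻¹ : ((ZMod q)⟦X⟧)ˣ) : (ZMod q)⟦X⟧)
      have h1 : PowerSeries.X ∣ w - (a.val : (ZMod q)⟦X⟧) * (c : (ZMod q)⟦X⟧) := by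
        have h2 : PowerSeries.constantCoeff ((c⁻¹ : ((ZMod q)⟦X⟧)ˣ) : (ZMod q)⟦X⟧) *
            PowerSeries.constantCoeff (c : (ZMod q)⟦X⟧) = 1 := by
          rw [← map_mul]; simp
        rw [PowerSeries.X_dvd_iff, map_sub, map_mul, map_natCast, ZMod.natCast_zmod_val, mul_assoc,
          h2, mul_one, sub_self]
      obtain ⟨x, hx⟩ := h1
      obtain ⟨y, hy⟩ := dvd_pow_sub_one_sub hc a.val
      obtain ⟨z, hz⟩ := hv.X_dvd_sub_one
      refine ⟨v * u ^ a.val, hv.mul (hu.pow _), x - z * (a.val * c) - v * y, ?_⟩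
      linear_combination hw + PowerSeries.X ^ (k + 3) * hx - v * hy
        - PowerSeries.X ^ (k + 3) * (a.val * c) * hz
  obtain ⟨v, hv, hd⟩ := key d
  exact hv.of_dvd_sub ((pow_dvd_pow _ (by omega)).trans hd)

theorem exists_isTournament_minorSum_eq [NeZero q] (d : ℕ) {c : ℕ → ZMod q} (h0 : c 0 = 1)
    (h1 : c 1 = 0) (h2 : c 2 = 0) :
    ∃ N : ℕ, ∀ n ≥ N, ∃ B : Matrix (Fin n) (Fin n) ℤ,
      IsTournament B ∧ ∀ i ≤ d, ((minorSum B i : ℤ) : ZMod q) = c i := by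
  have h3 : PowerSeries.X ^ 3 ∣ PowerSeries.mk c - 1 := by
    rw [PowerSeries.X_pow_dvd_iff]
    intro m hm
    interval_cases m <;> simp [PowerSeries.coeff_one, h0, h1, h2]
  obtain ⟨N, A, hA, hd⟩ := isTournamentSeries_of_X_pow_three_dvd d h3
  have key : ∀ n ≥ N, ∃ B : Matrix (Fin n) (Fin n) ℤ,
      IsTournament B ∧ minorPoly B = minorPoly A := by
    intro n hn
    induction n, hn using Nat.le_induction with
    | base => exact ⟨A, hA, rfl⟩
    | succ n _ ih =>
      obtain ⟨B, hB, hBA⟩ := ih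
      obtain ⟨D, hD, hDB⟩ := exists_isTournament_minorPoly_mul hB
        (B := (0 : Matrix (Fin 1) (Fin 1) ℤ))
        ⟨fun _ _ => Or.inl rfl, fun _ => rfl, fun i j h => (h (Subsingleton.elim i j)).elim⟩
      exact ⟨D, hD, by rw [hDB, hBA]; simp [minorPoly]⟩
  refine ⟨N, fun n hn => ?_⟩
  obtain ⟨B, hB, hBA⟩ := key n hn
  refine ⟨B, hB, fun i hi => ?_⟩
  rw [PowerSeries.X_pow_dvd_iff] at hd
  have := hd i (by omega)
  rw [map_sub, PowerSeries.coeff_mk, coeff_minorSeries, sub_eq_zero] at this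
  rw [this, ← coeff_minorPoly, hBA, coeff_minorPoly]

/-- The bound on the number of vertices can be chosen independently of the prescribed values, as
only finitely many of these matter. -/
theorem exists_forall_isTournament_minorSum_eq (q d : ℕ) [NeZero q] :
    ∃ N : ℕ, ∀ n ≥ N, ∀ c : ℕ → ZMod q, c 0 = 1 → c 1 = 0 → c 2 = 0 →
      ∃ B : Matrix (Fin n) (Fin n) ℤ,
        IsTournament B ∧ ∀ i ≤ d, ((minorSum B i : ℤ) : ZMod q) = c i := by
  have h (v : Fin (d + 3) → ZMod q) : ∃ N : ℕ, v 0 = 1 → v 1 = 0 → v 2 = 0 →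
      ∀ n ≥ N, ∃ B : Matrix (Fin n) (Fin n) ℤ,
        IsTournament B ∧ ∀ i : Fin (d + 3), ((minorSum B i : ℤ) : ZMod q) = v i := by
    by_cases hv : v 0 = 1 ∧ v 1 = 0 ∧ v 2 = 0
    · obtain ⟨N, hN⟩ := exists_isTournament_minorSum_eq (d + 2)
        (c := fun i => v (Fin.ofNat _ i)) hv.1 hv.2.1 hv.2.2
      refine ⟨N, fun _ _ _ n hn => ?_⟩
      obtain ⟨B, hB, hBv⟩ := hN n hn
      refine ⟨B, hB, fun i => ?_⟩
      rw [hBv i (by omega)]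
      simp
    · exact ⟨0, fun h0 h1 h2 => (hv ⟨h0, h1, h2⟩).elim⟩
  choose N hN using h
  refine ⟨Finset.univ.sup N, fun n hn c h0 h1 h2 => ?_⟩
  obtain ⟨B, hB, hBc⟩ := hN (fun i => c i) h0 h1
    (by simpa [Nat.mod_eq_of_lt (show 2 < d + 3 by omega)] using h2) n
    ((Finset.le_sup (Finset.mem_univ _)).trans hn)
  exact ⟨B, hB, fun i hi => hBc ⟨i, by omega⟩⟩

end

/-! ### Counting the coefficient classes -/

section Counting

theorem sum_range_even_ge_four (L : ℕ) :
    ∑ i ∈ Finset.range (L + 1), (if Even i ∧ 4 ≤ i then L + 1 - i else 0) =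
      (L - 1) / 2 * ((L - 2) / 2) := by
  have hcount (L : ℕ) :
      ∑ i ∈ Finset.range (L + 2), (if Even i ∧ 4 ≤ i then 1 else 0) = (L - 1) / 2 := by
    induction L with
    | zero => rfl
    | succ L ih =>
      rw [Finset.sum_range_succ, ih]
      split_ifs with h <;> rw [Nat.even_iff] at h <;> omega
  induction L with
  | zero => rfl
  | succ L ih =>
    have h : ∑ i ∈ Finset.range (L + 1 + 1), (if Even i ∧ 4 ≤ i then L + 1 + 1 - i else 0) =
        ∑ i ∈ Finset.range (L + 2), (if Even i ∧ 4 ≤ i then L + 1 - i else 0) +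
          ∑ i ∈ Finset.range (L + 2), (if Even i ∧ 4 ≤ i then 1 else 0) := by
      rw [← Finset.sum_add_distrib]
      refine Finset.sum_congr rfl fun i hi => ?_
      have := Finset.mem_range.mp hi
      split_ifs <;> omega
    rw [h, hcount, Finset.sum_range_succ, ih]
    rcases Nat.lt_or_ge L 2 with hL | hL
    · interval_cases L <;> rfl
    · rw [show L + 1 - 1 = (L - 2) + 2 by omega, show L + 1 - 2 = L - 1 by omega,
        Nat.add_div_right _ two_pos, Nat.sub_self, ite_self]
      ring

theorem card_filter_two_pow_dvd {e r : ℕ} (hr : r ≤ e) :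
    (Finset.univ.filter fun w : ZMod (2 ^ e) => (2 : ZMod (2 ^ e)) ^ r ∣ w).card = 2 ^ (e - r) := by
  have h : ((AddSubgroup.zmultiples ((2 ^ r : ℕ) : ZMod (2 ^ e)) : Set (ZMod (2 ^ e)))) =
      ↑(Finset.univ.filter fun w : ZMod (2 ^ e) => (2 : ZMod (2 ^ e)) ^ r ∣ w) := by
    ext w
    simp only [SetLike.mem_coe, AddSubgroup.mem_zmultiples_iff, Finset.coe_filter,
      Finset.mem_univ, true_and, Set.mem_ofPred_eq]
    constructor
    · rintro ⟨k, rfl⟩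
      exact ⟨k, by push_cast; rw [zsmul_eq_mul, mul_comm]⟩
    · rintro ⟨z, rfl⟩
      obtain ⟨k, rfl⟩ := ZMod.intCast_surjective z
      exact ⟨k, by push_cast; rw [zsmul_eq_mul, mul_comm]⟩
  rw [← Set.ncard_coe_finset, ← h, ← Nat.card_coe_set_eq]
  have := Nat.card_zmultiples ((2 ^ r : ℕ) : ZMod (2 ^ e))
  rw [ZMod.addOrderOf_coe _ (by positivity), Nat.gcd_eq_right (pow_dvd_pow 2 hr),
    Nat.pow_div hr two_pos] at this
  exact this

/-- If the possible values of the `i`-th term, given the previous ones, always form a coset of the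
multiples of `2 ^ r i`, then the number of initial segments is the product of the coset sizes. -/
theorem ncard_initial_segments {e : ℕ} (X : Set (ℕ → ZMod (2 ^ e))) (hX : X.Nonempty) (r : ℕ → ℕ)
    (L : ℕ) (hr : ∀ i < L, r i ≤ e)
    (hdvd : ∀ i < L, ∀ x ∈ X, ∀ y ∈ X, (∀ j < i, y j = x j) → 2 ^ r i ∣ y i - x i)
    (hex : ∀ i < L, ∀ x ∈ X, ∀ w, 2 ^ r i ∣ w → ∃ y ∈ X, (∀ j < i, y j = x j) ∧ y i = x i + w) :
    ((fun (x : ℕ → ZMod (2 ^ e)) (i : Fin L) => x i) '' X).ncard =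
      2 ^ ∑ i ∈ Finset.range L, (e - r i) := by
  classical
  induction L with
  | zero =>
    rw [Finset.sum_range_zero, pow_zero, Set.ncard_eq_one]
    obtain ⟨x, hx⟩ := hX
    exact ⟨_, (Set.eq_singleton_iff_unique_mem.mpr
      ⟨⟨x, hx, rfl⟩, fun y _ => Subsingleton.elim _ _⟩)⟩
  | succ L ih =>
    specialize ih (fun i hi => hr i (by omega)) (fun i hi => hdvd i (by omega))
      (fun i hi => hex i (by omega))
    rw [Set.ncard_eq_toFinset_card'] at ih ⊢
    rw [Finset.card_eq_sum_card_fiberwise (f := Fin.init)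
      (t := ((fun (x : ℕ → ZMod (2 ^ e)) (i : Fin L) => x i) '' X).toFinset), Finset.sum_range_succ,
      pow_add, ← ih, ← smul_eq_mul, ← Finset.sum_const]
    · refine Finset.sum_congr rfl fun v hv => ?_
      simp only [Set.mem_toFinset, Set.mem_image] at hv
      obtain ⟨x, hx, rfl⟩ := hv
      rw [← card_filter_two_pow_dvd (hr L (by omega))]
      refine Finset.card_bij' (fun v _ => v (Fin.last L) - x L)
        (fun w _ => Fin.snoc (α := fun _ => ZMod (2 ^ e)) (fun i : Fin L => x i) (x L + w))
        ?_ ?_ ?_ ?_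
      · intro v hv
        simp only [Finset.mem_filter, Set.mem_toFinset, Set.mem_image] at hv
        obtain ⟨⟨y, hy, rfl⟩, hyx⟩ := hv
        simp only [Finset.mem_filter, Finset.mem_univ, true_and]
        exact hdvd L (by omega) x hx y hy fun j hj => congrFun hyx ⟨j, hj⟩
      · intro w hw
        simp only [Finset.mem_filter, Finset.mem_univ, true_and] at hw
        obtain ⟨y, hy, hyx, hyL⟩ := hex L (by omega) x hx w hw
        simp only [Finset.mem_filter, Set.mem_toFinset, Set.mem_image]
        refine ⟨⟨y, hy, ?_⟩, Fin.init_snoc _ _⟩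
        ext i
        refine Fin.lastCases ?_ (fun i => ?_) i
        · simpa using hyL
        · simpa using hyx i i.2
      · intro v hv
        simp only [Finset.mem_filter] at hv
        rw [← hv.2]
        simp
      · intro w _
        simp
    · intro v hv
      simp only [Finset.mem_coe, Set.mem_toFinset, Set.mem_image] at hv ⊢
      obtain ⟨x, hx, rfl⟩ := hv
      exact ⟨x, hx, rfl⟩

end Counting

/-- The coefficient sequences modulo `2 ^ e` of the matrices `J - 2B`, for `B` the adjacency matrix
of a tournament on `n` vertices. -/
def coeffSequences (e n : ℕ) : Set (ℕ → ZMod (2 ^ e)) :=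
  {x | ∃ B : Matrix (Fin n) (Fin n) ℤ, IsTournament B ∧ ∀ j, x j =
    (charCoeff (of fun i j => 1 - 2 * B i j : Matrix (Fin n) (Fin n) ℤ) j : ZMod (2 ^ e))}

/-- The exponent `r` such that, given the preceding coefficients, the coefficient `a_i` ranges over
a coset of the multiples of `2 ^ r` modulo `2 ^ e`. -/
def cosetExponent (e n i : ℕ) : ℕ :=
  if Even i ∧ 4 ≤ i then (if Even n then i - 1 else i) else e

theorem isUnit_natCast_two_pow {e m : ℕ} (hm : Odd m) : IsUnit (m : ZMod (2 ^ e)) := by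
  rw [ZMod.isUnit_iff_coprime]
  exact (Nat.coprime_two_right.mpr hm).pow_right e

theorem zmod_two_pow_eq_zero (e : ℕ) : (2 : ZMod (2 ^ e)) ^ e = 0 := by
  exact_mod_cast ZMod.natCast_self (2 ^ e)

theorem two_pow_dvd_coeffSequences_sub {e n i : ℕ} (hi : i < n) {x y : ℕ → ZMod (2 ^ e)}
    (hx : x ∈ coeffSequences e n) (hy : y ∈ coeffSequences e n) (hxy : ∀ j < i, y j = x j) :
    2 ^ cosetExponent e n i ∣ y i - x i := by
  obtain ⟨A, hA, hAx⟩ := hx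
  obtain ⟨B, hB, hBy⟩ := hy
  have hodd (j : ℕ) (hj : Odd j) (hjn : j ≤ n) {z : ℕ → ZMod (2 ^ e)}
      {D : Matrix (Fin n) (Fin n) ℤ} (hD : IsTournament D) (hDz : ∀ j, z j =
        (charCoeff (of fun i j => 1 - 2 * D i j : Matrix (Fin n) (Fin n) ℤ) j : ZMod (2 ^ e))) :
      z j = -∑ i ∈ Finset.range j, 2 ^ (j - i - 1) * ((n - i).choose (j - i) : ZMod (2 ^ e)) *
        z i := by
    rw [hDz, hD.charCoeff_odd hj hjn]
    push_cast
    simp only [hDz]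
  have hdvd (j : ℕ) (hj : 1 ≤ j) (hjn : j ≤ n) {z : ℕ → ZMod (2 ^ e)}
      {D : Matrix (Fin n) (Fin n) ℤ} (hD : IsTournament D) (hDz : ∀ j, z j =
        (charCoeff (of fun i j => 1 - 2 * D i j : Matrix (Fin n) (Fin n) ℤ) j : ZMod (2 ^ e))) :
      2 ^ (j - 1) ∣ z j := by
    rw [hDz, hD.charCoeff_eq hj hjn]
    push_cast
    exact dvd_mul_right _ _
  unfold cosetExponent
  by_cases h4 : Even i ∧ 4 ≤ i
  · rw [if_pos h4]
    split_ifs with hn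
    · exact dvd_sub (hdvd i (by omega) hi.le hB hBy) (hdvd i (by omega) hi.le hA hAx)
    · have hio : Odd (i + 1) := h4.1.add_one
      have hx1 := hodd (i + 1) hio hi hA hAx
      have hy1 := hodd (i + 1) hio hi hB hBy
      rw [Finset.sum_range_succ] at hx1 hy1
      rw [Finset.sum_congr rfl fun j hj => by rw [hxy j (Finset.mem_range.mp hj)]] at hy1
      have hd := dvd_sub (hdvd (i + 1) (by omega) hi hA hAx) (hdvd (i + 1) (by omega) hi hB hBy)
      have hu : IsUnit ((n - i : ℕ) : ZMod (2 ^ e)) := by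
        refine isUnit_natCast_two_pow ?_
        rw [Nat.odd_sub hi.le]
        simp [h4.1, Nat.not_even_iff_odd.mp hn]
      rw [hx1, hy1, Nat.add_sub_cancel] at hd
      simp only [Nat.add_sub_cancel_left, Nat.sub_self, pow_zero, one_mul, Nat.choose_one_right,
        neg_sub_neg, add_sub_add_left_eq_sub, ← mul_sub] at hd
      exact hu.dvd_mul_left.mp hd
  · rw [if_neg h4, zmod_two_pow_eq_zero, zero_dvd_iff, sub_eq_zero]
    rcases Nat.even_or_odd i with he | ho
    · have hlt : i < 4 := by
        by_contra h
        exact h4 ⟨he, by omega⟩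
      have h02 : i = 0 ∨ i = 2 := by
        rw [Nat.even_iff] at he
        omega
      rcases h02 with rfl | rfl
      · rw [hAx, hBy]
        simp only [charCoeff, Nat.zero_le, if_true, charpoly_coeff_sub_fin _ (Nat.zero_le n),
          minorSum_zero]
      · rw [hAx, hBy, hA.charCoeff_eq (by norm_num) hi.le, hB.charCoeff_eq (by norm_num) hi.le]
        simp only [Finset.sum_range_succ, Finset.sum_range_zero, minorSum_zero, hA.minorSum_one,
          hA.minorSum_two, hB.minorSum_one, hB.minorSum_two]
    · rw [hodd i ho hi.le hA hAx, hodd i ho hi.le hB hBy,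
        Finset.sum_congr rfl fun j hj => by rw [hxy j (Finset.mem_range.mp hj)]]

/-- The effect on the coefficients of shifting the `p`-th sum of principal minors. -/
theorem charCoeff_shift {q n p : ℕ} {A B : Matrix (Fin n) (Fin n) ℤ} (hA : IsTournament A)
    (hB : IsTournament B) {j : ℕ} (hj : 1 ≤ j) (hjn : j ≤ n) (δ : ZMod q)
    (h : ∀ k ≤ j, ((minorSum B k : ℤ) : ZMod q) = (minorSum A k : ℤ) + if k = p then δ else 0) :
    (charCoeff (of fun i j => 1 - 2 * B i j : Matrix (Fin n) (Fin n) ℤ) j : ZMod q) =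
      (charCoeff (of fun i j => 1 - 2 * A i j : Matrix (Fin n) (Fin n) ℤ) j : ZMod q) +
      2 ^ (j - 1) * ((if j = p then δ else 0) +
        (-1) ^ j * if p ≤ j then ((n - p).choose (j - p) : ZMod q) * δ else 0) := by
  rw [hA.charCoeff_eq hj hjn, hB.charCoeff_eq hj hjn]
  push_cast
  rw [h j le_rfl, Finset.sum_congr rfl fun k hk => by
    rw [h k (Nat.lt_succ_iff.mp (Finset.mem_range.mp hk)), mul_add], Finset.sum_add_distrib]
  simp only [mul_ite, mul_zero, Finset.sum_ite_eq', Finset.mem_range, Nat.lt_succ_iff]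
  split_ifs <;> ring

theorem exists_mem_coeffSequences_add {e n : ℕ} (hen : e ≤ n)
    (hN : ∀ c : ℕ → ZMod (2 ^ e), c 0 = 1 → c 1 = 0 → c 2 = 0 →
      ∃ B : Matrix (Fin n) (Fin n) ℤ,
        IsTournament B ∧ ∀ i ≤ e, ((minorSum B i : ℤ) : ZMod (2 ^ e)) = c i)
    {i : ℕ} (hi : i ≤ e) {x : ℕ → ZMod (2 ^ e)} (hx : x ∈ coeffSequences e n) {w : ZMod (2 ^ e)}
    (hw : 2 ^ cosetExponent e n i ∣ w) :
    ∃ y ∈ coeffSequences e n, (∀ j < i, y j = x j) ∧ y i = x i + w := by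
  unfold cosetExponent at hw
  by_cases h4 : Even i ∧ 4 ≤ i
  · rw [if_pos h4] at hw
    obtain ⟨A, hA, hAx⟩ := hx
    have hex (p : ℕ) (hp : 3 ≤ p) (δ : ZMod (2 ^ e)) : ∃ B : Matrix (Fin n) (Fin n) ℤ,
        IsTournament B ∧ ∀ k ≤ e, ((minorSum B k : ℤ) : ZMod (2 ^ e)) =
          (minorSum A k : ℤ) + if k = p then δ else 0 := by
      refine hN _ ?_ ?_ ?_
      · rw [minorSum_zero, if_neg (by omega)]; simp
      · rw [hA.minorSum_one, if_neg (by omega)]; simp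
      · rw [hA.minorSum_two, if_neg (by omega)]; simp
    have h0 (D : Matrix (Fin n) (Fin n) ℤ) : charCoeff D 0 = 1 := by
      rw [charCoeff, if_pos (Nat.zero_le n), charpoly_coeff_sub_fin _ (Nat.zero_le n),
        minorSum_zero, pow_zero, one_mul]
    split_ifs at hw with hn
    · -- for even `n`, changing the minor sum of index `i - 1` leaves `a_{i - 1}` unchanged, and
      -- changes `a_i` by `2 ^ (i - 1)` times an odd multiple
      obtain ⟨z, rfl⟩ := hw
      have hu : IsUnit ((n - (i - 1) : ℕ) : ZMod (2 ^ e)) := by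
        refine isUnit_natCast_two_pow ?_
        rw [Nat.odd_sub (by omega)]
        have : Odd (i - 1) := Nat.Even.sub_odd (by omega) h4.1 odd_one
        simp [Nat.not_odd_iff_even.mpr hn, this]
      obtain ⟨u, hu⟩ := hu
      obtain ⟨B, hB, hBA⟩ := hex (i - 1) (by omega) ((u⁻¹ : (ZMod (2 ^ e))ˣ) * z)
      refine ⟨_, ⟨B, hB, fun j => rfl⟩, fun j hj => ?_, ?_⟩
      · rcases Nat.eq_zero_or_pos j with rfl | hj0
        · rw [hAx, h0, h0]
        · rw [hAx, charCoeff_shift hA hB hj0 (by omega) _ fun k hk => hBA k (by omega)]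
          rcases eq_or_ne j (i - 1) with rfl | hne
          · have : Odd (i - 1) := Nat.Even.sub_odd (by omega) h4.1 odd_one
            simp [this.neg_one_pow]
          · rw [if_neg hne, if_neg (by omega)]
            simp
      · rw [hAx, charCoeff_shift hA hB (by omega) (by omega) _ fun k hk => hBA k (by omega),
          if_neg (by omega), if_pos (by omega), h4.1.neg_one_pow,
          show i - (i - 1) = 1 by omega, Nat.choose_one_right, ← hu]
        simp
    · -- for odd `n`, changing the minor sum of index `i` changes `a_i` by `2 ^ i` times as much
      obtain ⟨z, rfl⟩ := hw
      obtain ⟨B, hB, hBA⟩ := hex i (by omega) z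
      refine ⟨_, ⟨B, hB, fun j => rfl⟩, fun j hj => ?_, ?_⟩
      · rcases Nat.eq_zero_or_pos j with rfl | hj0
        · rw [hAx, h0, h0]
        · rw [hAx, charCoeff_shift hA hB hj0 (by omega) _ fun k hk => hBA k (by omega),
            if_neg (by omega), if_neg (by omega)]
          simp
      · rw [hAx, charCoeff_shift hA hB (by omega) (by omega) _ fun k hk => hBA k (by omega),
          if_pos rfl, if_pos le_rfl, h4.1.neg_one_pow, Nat.sub_self, Nat.choose_zero_right]
        obtain ⟨k, rfl⟩ : ∃ k, i = k + 1 := ⟨i - 1, by omega⟩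
        rw [Nat.add_sub_cancel]
        push_cast
        ring
  · rw [if_neg h4, zmod_two_pow_eq_zero, zero_dvd_iff] at hw
    exact ⟨x, hx, fun _ _ => rfl, by rw [hw, add_zero]⟩

theorem theorem3 (e : ℕ) (he : 3 ≤ e) :
    ∃ N : ℕ, ∀ n : ℕ, N < n →
      (coeffClasses e (skewSignMatrices n)).ncard =
        if Even n then 2 ^ (((e - 1) / 2) * ((e - 2) / 2))
        else 2 ^ (((e - 2) / 2) * ((e - 3) / 2)) := by
  obtain ⟨N, hN⟩ := exists_forall_isTournament_minorSum_eq (2 ^ e) e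
  refine ⟨max N e, fun n hn => ?_⟩
  have hen : e < n := (le_max_right _ _).trans_lt hn
  specialize hN n ((le_max_left _ _).trans hn.le)
  have hne : (coeffSequences e n).Nonempty := by
    obtain ⟨B, hB, -⟩ := hN (fun i => if i = 0 then 1 else 0) rfl rfl rfl
    exact ⟨_, B, hB, fun _ => rfl⟩
  have hdvd : ∀ i < e + 1, ∀ x ∈ coeffSequences e n, ∀ y ∈ coeffSequences e n,
      (∀ j < i, y j = x j) → 2 ^ cosetExponent e n i ∣ y i - x i :=
    fun i hi x hx y hy hxy => two_pow_dvd_coeffSequences_sub (by omega) hx hy hxy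
  have hcard := ncard_initial_segments (coeffSequences e n) hne (cosetExponent e n) (e + 1)
    (fun i hi => by unfold cosetExponent; split_ifs <;> omega) hdvd
    (fun i hi x hx w hw => exists_mem_coeffSequences_add hen.le hN (by omega) hx hw)
  have himage : coeffClasses e (skewSignMatrices n) =
      (fun (v : Fin (e + 1) → ZMod (2 ^ e)) (i : Set.Icc 2 e) =>
        v ⟨i, Nat.lt_succ_of_le i.2.2⟩) ''
      ((fun (x : ℕ → ZMod (2 ^ e)) (i : Fin (e + 1)) => x i) '' coeffSequences e n) := by
    rw [Set.image_image]
    ext c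
    constructor
    · rintro ⟨M, hM, hc⟩
      obtain ⟨B, hB, rfl⟩ := (mem_skewSignMatrices_iff M).mp hM
      exact ⟨_, ⟨B, hB, fun _ => rfl⟩, funext fun i => (hc i).symm⟩
    · rintro ⟨x, ⟨B, hB, hx⟩, rfl⟩
      exact ⟨_, (mem_skewSignMatrices_iff _).mpr ⟨B, hB, rfl⟩, fun i => hx i⟩
  -- the coefficients `a_0` and `a_1`, which the classes leave out, are constant
  have hinj : Set.InjOn (fun (v : Fin (e + 1) → ZMod (2 ^ e)) (i : Set.Icc 2 e) =>
        v ⟨i, Nat.lt_succ_of_le i.2.2⟩)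
      ((fun (x : ℕ → ZMod (2 ^ e)) (i : Fin (e + 1)) => x i) '' coeffSequences e n) := by
    rintro _ ⟨x, hx, rfl⟩ _ ⟨y, hy, rfl⟩ hxy
    have h0 : x 0 = y 0 := by
      have := hdvd 0 (by omega) y hy x hx (by simp)
      simpa [cosetExponent, zmod_two_pow_eq_zero, sub_eq_zero] using this
    have h1 : x 1 = y 1 := by
      have := hdvd 1 (by omega) y hy x hx (by simpa using h0)
      simpa [cosetExponent, zmod_two_pow_eq_zero, sub_eq_zero] using this
    ext ⟨i, hi⟩
    rcases Nat.lt_or_ge i 2 with h | h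
    · interval_cases i
      · exact h0
      · exact h1
    · exact congrFun hxy ⟨i, h, by omega⟩
  rw [himage, hinj.ncard_image, hcard]
  split_ifs with hn2
  · rw [← sum_range_even_ge_four]
    congr 1
    refine Finset.sum_congr rfl fun i hi => ?_
    have := Finset.mem_range.mp hi
    unfold cosetExponent
    split_ifs <;> omega
  · obtain ⟨d, rfl⟩ : ∃ d, e = d + 1 := ⟨e - 1, by omega⟩
    have h := sum_range_even_ge_four d
    rw [show d + 1 - 2 = d - 1 by omega, show d + 1 - 3 = d - 2 by omega, ← h,
      Finset.sum_range_succ]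
    congr 1
    have hlast : d + 1 - cosetExponent (d + 1) n (d + 1) = 0 := by
      unfold cosetExponent
      split_ifs <;> omega
    rw [hlast, add_zero]
    refine Finset.sum_congr rfl fun i _ => ?_
    unfold cosetExponent
    split_ifs <;> omega
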